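/- All graphs are finite and simple. A graph is outerplanar if it can be drawn without crossings in a closed disc of the plane with all its vertices on the bounding circle (that is, drawn in the plane with all vertices on the outer face). In the game of $k$ lazy zombies and a survivor on a connected graph $G$, an adversary first places the $k$ zombies on vertices of $G$, and then the survivor, seeing them, chooses a starting vertex. After that, in each round, every zombie either stays where it is or moves along the first edge of a shortest path (of its choice) from its vertex to the survivor's current vertex, and then the survivor stays or moves to an adjacent vertex. The zombies win if after finitely many rounds some zombie is on the survivor's vertex. The universal lazy zombie number $u_L(G)$ is the least $k$ such that $k$ lazy zombies can force a win from all starting positions chosen by the adversary. Two lazy zombies are always enough, and sometimes needed, on connected outerplanar graphs: for every connected outerplanar graph $G$, two lazy zombies can force a win from all starting positions chosen by the adversary, so $u_L(G)\le 2$, and $u_L(G)=2$ unless a single lazy zombie can force a win from every starting vertex (in which case $u_L(G)<2$). The value $2$ is attained: the $4$-cycle is connected and outerplanar and $u_L(C_4)=2$. -/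

import Mathlib

/-! ### Outerplanar graphs -/

/-- `G` is outerplanar: it has a crossing-free drawing in a closed disc of the plane with all its
vertices on the bounding circle (so that all of them lie on the outer face). The vertices are
distinct points of the unit circle, every edge is drawn as a simple curve in the closed unit disc
joining its two ends and passing through no other vertex, and two different edges meet at most in
a common end. -/
def IsOuterplanar {V : Type*} (G : SimpleGraph V) : Prop :=
  ∃ (pos : V → ℂ) (arc : Sym2 V → Set ℂ),
    Function.Injective pos ∧
    (∀ v, pos v ∈ Metric.sphere (0 : ℂ) 1) ∧
    (∀ u v, G.Adj u v →
      ∃ γ : Path (pos u) (pos v), Function.Injective γ ∧ Set.range γ = arc s(u, v)) ∧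
    (∀ e ∈ G.edgeSet, arc e ⊆ Metric.closedBall (0 : ℂ) 1) ∧
    (∀ e ∈ G.edgeSet, ∀ w, pos w ∈ arc e → w ∈ e) ∧
    (∀ e ∈ G.edgeSet, ∀ e' ∈ G.edgeSet, e ≠ e' →
      arc e ∩ arc e' ⊆ pos '' {w | w ∈ e ∧ w ∈ e'})

namespace LazyZombies

variable {V : Type*}

/-- While the survivor is at `s`, a lazy zombie at `x` may go to `y`: it stays still, or it follows
the first edge of some shortest path from `x` to `s`. -/
def ZombieMove (G : SimpleGraph V) (s x y : V) : Prop :=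
  y = x ∨ ∃ (h : G.Adj x y) (p : G.Walk y s), (SimpleGraph.Walk.cons h p).length = G.dist x s

/-- The survivor waits or moves along an edge. -/
def SurvivorMove (G : SimpleGraph V) (s t : V) : Prop :=
  t = s ∨ G.Adj s t

/-- Some zombie is on the survivor's vertex. -/
def Caught {k : ℕ} (z : Fin k → V) (s : V) : Prop :=
  ∃ i, z i = s

/-- The `k` lazy zombies, standing at `z` and about to move while the survivor stands at `s`, can
force the capture of the survivor within finitely many rounds. In a round every zombie
moves (or stays still), and then, unless it is caught, the survivor moves (or waits). -/
inductive CanCatch (G : SimpleGraph V) {k : ℕ} : (Fin k → V) → V → Prop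
  | caught {z : Fin k → V} {s : V} (hc : Caught z s) : CanCatch G z s
  | capture {z : Fin k → V} {s : V} (z' : Fin k → V)
      (hz : ∀ i, ZombieMove G s (z i) (z' i)) (hc : Caught z' s) : CanCatch G z s
  | round {z : Fin k → V} {s : V} (z' : Fin k → V)
      (hz : ∀ i, ZombieMove G s (z i) (z' i))
      (hs : ∀ t, SurvivorMove G s t → CanCatch G z' t) : CanCatch G z s

/-- `k` lazy zombies catch the survivor on `G` when an adversary assigns their starting positions
`z` and the survivor, knowing them, then chooses its starting position `s`. -/
def UniversallyWin (G : SimpleGraph V) (k : ℕ) : Prop :=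
  ∀ (z : Fin k → V) (s : V), CanCatch G z s

/-- The universal lazy zombie number `u_L(G)`: the minimum number of lazy zombies that catch the
survivor from starting positions chosen by an adversary (`⊤` if no number of them does). -/
noncomputable def universalLazyZombieNumber (G : SimpleGraph V) : ℕ∞ :=
  ⨅ k ∈ {k : ℕ | UniversallyWin G k}, (k : ℕ∞)

end LazyZombies

/-! ### Non-crossing chords, walks and shortest paths. -/

section

open SimpleGraph Relation

variable {V : Type*}

/-! The drawing is used only through the order of the vertices on the circle: curves in the disc
with alternating ends meet (`exists_eq_of_alternating`), so no two edges cross as chords. The rest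
is combinatorial.

Suppose an edge `xy` crosses the chord `ab` between the zombies. Then they are on opposite sides of
`xy`, and at least one of them is not on the survivor's side. All its routes to the survivor pass
`x` or `y`, so it can approach this edge along a shortest path (`exists_move_toward_edge`). Such a
step creates no new crossing edge (`crossingEdges_subset`), and on reaching `x` or `y` the zombie
removes the crossing with `xy`. Hence induction on the number of crossing edges (`canCatch`).

Once no edge crosses `ab`, the survivor's territory and its frontier lie on one side of the chord,
and `canCatch_of_oneSided` is an induction on the size of the territory. Let `y` be a frontier
vertex nearest to the survivor, with `a` next to it. If `b` guards the rest of the frontier, `a`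
steps to `y` and the territory shrinks. Otherwise the frontier has only two vertices and `a` guards
both (`OneSided.frontier_subset_pair`). The other zombie is then free to walk up to `a` or to a
frontier vertex (`canCatch_of_guarding`), after which the territory can be shrunk again. -/

/-- For vertices placed on a circle in the order given by `f`, the chord `uv` separates `p`
from `q`. -/
def Separates (f : V → ℕ) (u v p q : V) : Prop :=
  f u ≠ f v ∧ f p ≠ f u ∧ f p ≠ f v ∧ f q ≠ f u ∧ f q ≠ f v ∧
    -- Each inner equivalence says that the point is not between `u` and `v` in the linear order.
    ¬ ((f p < f u ↔ f p < f v) ↔ (f q < f u ↔ f q < f v))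

theorem Separates.symm_left {f : V → ℕ} {u v p q : V} (h : Separates f u v p q) :
    Separates f v u p q := by
  unfold Separates at *; omega

theorem Separates.symm_right {f : V → ℕ} {u v p q : V} (h : Separates f u v p q) :
    Separates f u v q p := by
  unfold Separates at *; omega

/-- No two edges of `G` cross when its vertices are placed on a circle in the order given by `f`
and its edges are drawn as chords. -/
structure CirclePlacement (G : SimpleGraph V) (f : V → ℕ) : Prop where
  injective : Function.Injective f
  noncrossing : ∀ ⦃u v p q⦄, G.Adj u v → G.Adj p q → ¬ Separates f u v p q

/-- `q` is reached from `p` by a walk whose vertices after `p` avoid `K`. -/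
def LinkedAvoiding (G : SimpleGraph V) (K : Set V) : V → V → Prop :=
  ReflTransGen fun p q => G.Adj p q ∧ q ∉ K

namespace LinkedAvoiding

variable {G : SimpleGraph V} {K L : Set V} {p q r : V}

theorem mono (h : LinkedAvoiding G K p q) (hLK : L ⊆ K) : LinkedAvoiding G L p q :=
  ReflTransGen.mono (fun _ _ h => ⟨h.1, fun hq => h.2 (hLK hq)⟩) _ _ h

theorem symm (h : LinkedAvoiding G K p q) (hp : p ∉ K) : LinkedAvoiding G K q p := by
  induction h with
  | refl => exact .refl
  | @tail b c hb hc ih =>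
    refine .head ⟨hc.1.symm, ?_⟩ ih
    rcases ReflTransGen.cases_tail hb with h | ⟨_, _, h⟩
    · rwa [h]
    · exact h.2

theorem notMem (h : LinkedAvoiding G K p q) (hp : p ∉ K) : q ∉ K := by
  rcases ReflTransGen.cases_tail h with h | ⟨_, _, h⟩
  · rwa [h]
  · exact h.2

/-- A walk that avoids `a` and `b` and gets from one side of the chord `ab` to the other
has an edge that crosses this chord. -/
theorem exists_separated_edge {f : V → ℕ} (hf : Function.Injective f) {a b : V}
    (h : LinkedAvoiding G {a, b} p q) (hs : Separates f a b p q) :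
    ∃ u v, G.Adj u v ∧ Separates f a b u v := by
  induction h with
  | refl => unfold Separates at hs; omega
  | @tail c d hc hd ih =>
    by_cases hpc : Separates f a b p c
    · exact ih hpc
    · refine ⟨c, d, hd.1, ?_⟩
      have hp : p ∉ ({a, b} : Set V) := by
        rintro (h | h) <;> (subst h; unfold Separates at hs; omega)
      have hcn := LinkedAvoiding.notMem hc hp
      simp only [Set.mem_insert_iff, Set.mem_singleton_iff, not_or] at hcn
      have h1 := hf.ne hcn.1
      have h2 := hf.ne hcn.2
      unfold Separates at *; omega

/-- A walk that avoids the ends of an edge stays on one side of it. -/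
theorem not_separates {f : V → ℕ} (hG : CirclePlacement G f) {a b : V} (hab : G.Adj a b)
    (h : LinkedAvoiding G {a, b} p q) : ¬ Separates f a b p q := fun hs =>
  let ⟨_, _, huv, hs'⟩ := h.exists_separated_edge hG.injective hs
  hG.noncrossing hab huv hs'

end LinkedAvoiding

/-- If no walk from `z` to `s` avoids `K`, then some shortest one passes a vertex of `K`. -/
theorem exists_mem_dist_eq {G : SimpleGraph V} (hG : G.Connected) {K : Set V} {z s : V}
    (h : ¬ LinkedAvoiding G K z s) : ∃ w ∈ K, G.dist z s = G.dist z w + G.dist w s := by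
  obtain ⟨p, hp⟩ := hG.exists_walk_length_eq_dist z s
  have key : ∀ w ∈ p.support, G.dist z s = G.dist z w + G.dist w s := by
    intro w hw
    classical
    have h1 := congrArg Walk.length (p.take_spec hw)
    rw [Walk.length_append] at h1
    have h2 := dist_le (p.takeUntil w hw)
    have h3 := dist_le (p.dropUntil w hw)
    have h4 := hG.dist_triangle (u := z) (v := w) (w := s)
    omega
  by_contra! hcon
  refine h ?_
  have hav : ∀ w ∈ p.support, w ∉ K := fun w hw hK => hcon w hK (key _ hw)
  clear hcon key hp h
  induction p with
  | nil => exact .refl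
  | cons hadj p ih =>
    refine .head ⟨hadj, hav _ (by simp)⟩ (ih fun w hw => hav w (by simp [hw]))

namespace LazyZombies

variable {G : SimpleGraph V}

theorem zombieMove_of_dist (hG : G.Connected) {s x y : V} (h : G.Adj x y)
    (hd : G.dist x s = G.dist y s + 1) : ZombieMove G s x y := by
  obtain ⟨p, hp⟩ := hG.exists_walk_length_eq_dist y s
  exact .inr ⟨h, p, by rw [Walk.length_cons, hp, hd]⟩

theorem exists_adj_dist (hG : G.Connected) {z x : V} (h : z ≠ x) :
    ∃ z', G.Adj z z' ∧ G.dist z x = G.dist z' x + 1 := by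
  obtain ⟨p, hp⟩ := hG.exists_walk_length_eq_dist z x
  cases p with
  | nil => exact absurd rfl h
  | @cons _ z' _ hadj p =>
    refine ⟨z', hadj, ?_⟩
    have h1 := dist_le p
    have h2 := hG.dist_triangle (u := z) (v := z') (w := x)
    rw [dist_eq_one_iff_adj.mpr hadj] at h2
    rw [Walk.length_cons] at hp
    omega

/-- A zombie that cannot reach the survivor without meeting the edge `xy` can approach one end of the edge without going away from the other. -/
theorem exists_move_toward_edge (hG : G.Connected) {x y z s : V} (hxy : G.Adj x y)
    (hzx : z ≠ x) (hzy : z ≠ y)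
    (hs : ¬ LinkedAvoiding G {x, y} z s) :
    ∃ z', G.Adj z z' ∧ G.dist z s = G.dist z' s + 1 ∧
      G.dist z' x + G.dist z' y < G.dist z x + G.dist z y := by
  wlog hx : G.dist z s = G.dist z x + G.dist x s generalizing x y
  · obtain ⟨w, rfl | rfl, hw⟩ := exists_mem_dist_eq hG hs
    · exact absurd hw hx
    rw [Set.pair_comm] at hs
    obtain ⟨z', h1, h2, h3⟩ := this hxy.symm hzy hzx hs hw
    exact ⟨z', h1, h2, by omega⟩
  have t1 := hG.dist_triangle (u := z) (v := x) (w := y)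
  have t2 := hG.dist_triangle (u := z) (v := y) (w := x)
  have t3 := hG.dist_triangle (u := y) (v := x) (w := s)
  have e := dist_eq_one_iff_adj.mpr hxy
  have e' := dist_eq_one_iff_adj.mpr hxy.symm
  -- A step towards the nearer end brings the zombie closer to it, and the edge `xy` bounds the new
  -- distance to the other end by the old one.
  by_cases hle : G.dist z x ≤ G.dist z y
  · obtain ⟨z', h1, h2⟩ := exists_adj_dist hG hzx
    have t4 := hG.dist_triangle (u := z') (v := x) (w := y)
    have t5 := hG.dist_triangle (u := z') (v := x) (w := s)
    have t6 := hG.dist_triangle (u := z) (v := z') (w := s)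
    have e1 := dist_eq_one_iff_adj.mpr h1
    exact ⟨z', h1, by omega, by omega⟩
  -- Here `y` is nearer by exactly one, so going to `x` through `y` is also shortest, and the step
  -- towards `y` is a legal zombie move.
  · obtain ⟨z', h1, h2⟩ := exists_adj_dist hG hzy
    have t4 := hG.dist_triangle (u := z') (v := y) (w := x)
    have t5 := hG.dist_triangle (u := z') (v := y) (w := s)
    have t6 := hG.dist_triangle (u := z) (v := z') (w := s)
    have e1 := dist_eq_one_iff_adj.mpr h1
    exact ⟨z', h1, by omega, by omega⟩

end LazyZombies

end

/-! ### The survivor's territory and its frontier. -/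

section

open SimpleGraph Relation

variable {V : Type*}

namespace LazyZombies

variable {G : SimpleGraph V} {a b s t p q y : V}

theorem CanCatch.comp_perm {k : ℕ} {z : Fin k → V} (h : CanCatch G z s)
    (σ : Equiv.Perm (Fin k)) : CanCatch G (z ∘ σ) s := by
  have aux : ∀ {z : Fin k → V} {s : V}, Caught z s → Caught (z ∘ σ) s :=
    fun ⟨i, hi⟩ => ⟨σ.symm i, by simpa using hi⟩
  induction h with
  | caught hc => exact .caught (aux hc)
  | capture z' hz hc => exact .capture (z' ∘ σ) (fun i => hz (σ i)) (aux hc)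
  | round z' hz _ ih => exact .round (z' ∘ σ) (fun i => hz (σ i)) ih

theorem CanCatch.swap (h : CanCatch G ![a, b] s) : CanCatch G ![b, a] s := by
  have := h.comp_perm (Equiv.swap 0 1)
  convert this using 1
  ext i
  fin_cases i <;> simp

theorem CanCatch.of_moves {a' b' : V} (ha : ZombieMove G s a a') (hb : ZombieMove G s b b')
    (h : ∀ t, SurvivorMove G s t → CanCatch G ![a', b'] t) : CanCatch G ![a, b] s :=
  .round ![a', b'] (Fin.forall_fin_two.2 ⟨ha, hb⟩) h

/-- The vertices on which zombies at `a` and `b` stand or which they can reach in one step. -/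
def guarded (G : SimpleGraph V) (a b : V) : Set V :=
  {t | (t = a ∨ G.Adj a t) ∨ (t = b ∨ G.Adj b t)}

theorem guarded_comm (G : SimpleGraph V) (a b : V) : guarded G a b = guarded G b a := by
  ext; exact or_comm

theorem CanCatch.of_guarded (hG : G.Connected) (h : s ∈ guarded G a b) :
    CanCatch G ![a, b] s := by
  have key : ∀ a b, (s = a ∨ G.Adj a s) → CanCatch G ![a, b] s := by
    rintro a b (rfl | h)
    · exact .caught ⟨0, rfl⟩
    · exact .capture ![s, b]
        (Fin.forall_fin_two.2 ⟨zombieMove_of_dist hG h (by simp [dist_eq_one_iff_adj.mpr h]),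
          .inl rfl⟩) ⟨0, rfl⟩
  rcases h with h | h
  · exact key a b h
  · exact (key b a h).swap

/-- The vertices that a survivor on `s` can reach while zombies guard from `a` and `b`. -/
def territory (G : SimpleGraph V) (a b s : V) : Set V :=
  {t | LinkedAvoiding G (guarded G a b) s t}

theorem territory_comm (G : SimpleGraph V) (a b s : V) :
    territory G a b s = territory G b a s := by
  rw [territory, guarded_comm, territory]

theorem mem_territory_self (G : SimpleGraph V) (a b s : V) : s ∈ territory G a b s := .refl

theorem notMem_guarded (hs : s ∉ guarded G a b) (ht : t ∈ territory G a b s) :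
    t ∉ guarded G a b := LinkedAvoiding.notMem ht hs

theorem mem_territory_of_adj (ht : t ∈ territory G a b s) (h : G.Adj t p)
    (hp : p ∉ guarded G a b) : p ∈ territory G a b s := ht.tail ⟨h, hp⟩

theorem territory_eq (hs : s ∉ guarded G a b) (ht : t ∈ territory G a b s) :
    territory G a b t = territory G a b s := by
  ext u
  exact ⟨fun h => ReflTransGen.trans ht h, fun h => (LinkedAvoiding.symm ht hs).trans h⟩

/-- The vertices outside the territory that are adjacent to it. -/
def frontier (G : SimpleGraph V) (a b s : V) : Set V :=
  {y | y ∉ territory G a b s ∧ ∃ t ∈ territory G a b s, G.Adj t y}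

theorem frontier_comm (G : SimpleGraph V) (a b s : V) :
    frontier G a b s = frontier G b a s := by
  rw [frontier, territory_comm, frontier]

theorem left_notMem_frontier (hs : s ∉ guarded G a b) : a ∉ frontier G a b s :=
  fun ⟨_, _, ht, h⟩ => notMem_guarded hs ht (.inl (.inr h.symm))

theorem right_notMem_frontier (hs : s ∉ guarded G a b) : b ∉ frontier G a b s :=
  fun ⟨_, _, ht, h⟩ => notMem_guarded hs ht (.inr (.inr h.symm))

/-- Only guarding can keep such a vertex out of the territory, and a zombie cannot stand on it,
since its neighbours in the territory are unguarded. -/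
theorem adj_of_mem_frontier (hs : s ∉ guarded G a b) (hy : y ∈ frontier G a b s) :
    G.Adj a y ∨ G.Adj b y := by
  obtain ⟨hy1, t, ht, h⟩ := id hy
  by_contra hcon
  refine hy1 (mem_territory_of_adj ht h ?_)
  rintro ((rfl | h) | (rfl | h))
  · exact left_notMem_frontier hs hy
  · exact hcon (.inl h)
  · exact right_notMem_frontier hs hy
  · exact hcon (.inr h)

/-- Between vertices of the territory and its frontier, the survivor can walk through the
territory only. -/
theorem linkedAvoiding_of_mem {K : Set V}
    (hK : ∀ t ∈ territory G a b s, t ∉ K)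
    (hp : p ∈ territory G a b s ∪ frontier G a b s)
    (hq : q ∈ territory G a b s ∪ frontier G a b s) (hpK : p ∉ K) (hqK : q ∉ K) :
    LinkedAvoiding G K p q := by
  have key : ∀ {q}, q ∈ territory G a b s → LinkedAvoiding G K s q := by
    intro q hq
    induction hq with
    | refl => exact .refl
    | tail hb hc ih => exact ih.tail ⟨hc.1, hK _ (hb.tail hc)⟩
  have key' : ∀ {q}, q ∈ territory G a b s ∪ frontier G a b s → q ∉ K →
      LinkedAvoiding G K s q := by
    rintro q (hq | ⟨-, t, ht, h⟩) hqK
    · exact key hq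
    · exact (key ht).tail ⟨h, hqK⟩
  exact ((key' hp hpK).symm (hK _ (mem_territory_self ..))).trans (key' hq hqK)

/-- A survivor that does not step next to a zombie stays in its territory if the zombies guard
the frontier after their moves. -/
theorem mem_territory_of_move {a' b' : V}
    (hfr : frontier G a b s ⊆ guarded G a' b') (hst : SurvivorMove G s t)
    (ht : t ∉ guarded G a' b') : t ∈ territory G a b s := by
  rcases hst with rfl | h
  · exact mem_territory_self ..
  · by_contra hcon
    exact ht (hfr ⟨hcon, s, mem_territory_self .., h⟩)

theorem territory_subset {a' b' : V}
    (hfr : frontier G a b s ⊆ guarded G a' b') (ht : t ∈ territory G a b s) :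
    territory G a' b' t ⊆ territory G a b s := by
  intro u hu
  induction hu with
  | refl => exact ht
  | tail _ hc ih =>
    by_contra hcon
    exact hc.2 (hfr ⟨hcon, _, ih, hc.1⟩)

theorem territory_union_frontier_subset {a' b' : V}
    (hfr : frontier G a b s ⊆ guarded G a' b') (ht : t ∈ territory G a b s) :
    territory G a' b' t ∪ frontier G a' b' t ⊆ territory G a b s ∪ frontier G a b s := by
  rintro u (hu | ⟨-, v, hv, h⟩)
  · exact .inl (territory_subset hfr ht hu)
  · by_cases hu : u ∈ territory G a b s
    · exact .inl hu
    · exact .inr ⟨hu, v, territory_subset hfr ht hv, h⟩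

theorem ncard_territory_lt [Finite V] {a' b' : V}
    (hfr : frontier G a b s ⊆ guarded G a' b') (ht : t ∈ territory G a b s)
    (htg : t ∉ guarded G a' b') (hy : y ∈ frontier G a b s) (hy' : y = a' ∨ y = b') :
    (territory G a' b' t).ncard < (territory G a b s).ncard := by
  refine Set.ncard_lt_ncard ⟨territory_subset hfr ht, fun hsub => ?_⟩ (Set.toFinite _)
  obtain ⟨-, u, hu, h⟩ := hy
  refine notMem_guarded htg (hsub hu) ?_
  rcases hy' with rfl | rfl
  · exact .inl (.inr h.symm)
  · exact .inr (.inr h.symm)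

/-- The territory and its frontier lie on one side of the chord between the zombies. -/
def OneSided (G : SimpleGraph V) (f : V → ℕ) (a b s : V) : Prop :=
  ∀ p ∈ territory G a b s ∪ frontier G a b s, ∀ q ∈ territory G a b s ∪ frontier G a b s,
    ¬ Separates f a b p q

theorem OneSided.swap {f : V → ℕ} (h : OneSided G f a b s) : OneSided G f b a s := by
  intro p hp q hq hs
  rw [territory_comm, frontier_comm] at hp hq
  exact h p hp q hq hs.symm_left

theorem left_notMem (hs : s ∉ guarded G a b) :
    a ∉ territory G a b s ∪ frontier G a b s := by
  rintro (h | h)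
  · exact notMem_guarded hs h (.inl (.inl rfl))
  · exact left_notMem_frontier hs h

theorem right_notMem (hs : s ∉ guarded G a b) :
    b ∉ territory G a b s ∪ frontier G a b s := by
  rintro (h | h)
  · exact notMem_guarded hs h (.inr (.inl rfl))
  · exact right_notMem_frontier hs h

theorem linkedAvoiding_pair (hs : s ∉ guarded G a b)
    (hp : p ∈ territory G a b s ∪ frontier G a b s)
    (hq : q ∈ territory G a b s ∪ frontier G a b s) : LinkedAvoiding G {a, b} p q := by
  have key : ∀ {q}, q ∈ territory G a b s ∪ frontier G a b s → q ∉ ({a, b} : Set V) := by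
    rintro q hq (rfl | rfl)
    · exact left_notMem hs hq
    · exact right_notMem hs hq
  exact linkedAvoiding_of_mem (fun t ht => key (.inl ht)) hp hq (key hp) (key hq)

theorem OneSided.of_adj {f : V → ℕ} (hf : CirclePlacement G f) (hab : G.Adj a b)
    (hs : s ∉ guarded G a b) : OneSided G f a b s := fun _ hp _ hq =>
  (linkedAvoiding_pair hs hp hq).not_separates hf hab

/-- Some frontier vertex lies on shortest paths to the survivor from all zombies next to it. -/
theorem exists_nearest_mem_frontier [Finite V] (hG : G.Connected) (hs : s ∉ guarded G a b) :
    ∃ y ∈ frontier G a b s, ∀ c, (c = a ∨ c = b) → G.Adj c y →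
      G.dist c s = G.dist y s + 1 := by
  have key : ∀ c, (c = a ∨ c = b) →
      ∃ w ∈ frontier G a b s, G.dist c s = G.dist c w + G.dist w s := by
    intro c hc
    refine exists_mem_dist_eq hG fun h => ?_
    have hcn : c ∉ territory G a b s ∪ frontier G a b s := by
      rcases hc with rfl | rfl
      · exact left_notMem hs
      · exact right_notMem hs
    have h' := h.symm fun hc => hcn (.inr hc)
    have : ∀ {u}, LinkedAvoiding G (frontier G a b s) s u → u ∈ territory G a b s := by
      intro u hu
      induction hu with
      | refl => exact mem_territory_self ..
      | tail _ hd ih =>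
        by_contra hcon
        exact hd.2 ⟨hcon, _, ih, hd.1⟩
    exact hcn (.inl (this h'))
  obtain ⟨w, hw, -⟩ := key a (.inl rfl)
  -- A shortest path from a zombie to the survivor has to cross the frontier at least one step away
  -- from the zombie, so a zombie next to a nearest frontier vertex loses nothing by going there.
  obtain ⟨y, hy, hmin⟩ := Set.exists_min_image (frontier G a b s) (fun y => G.dist y s)
    (Set.toFinite _) ⟨w, hw⟩
  refine ⟨y, hy, fun c hc hcy => ?_⟩
  obtain ⟨v, hv, h⟩ := key c hc
  have h1 := hmin v hv
  have h2 : G.dist c v ≠ 0 := by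
    rw [hG.dist_eq_zero_iff.ne]
    rintro rfl
    rcases hc with rfl | rfl
    · exact left_notMem_frontier hs hv
    · exact right_notMem_frontier hs hv
  have h3 := hG.dist_triangle (u := c) (v := y) (w := s)
  rw [dist_eq_one_iff_adj.mpr hcy] at h3
  omega

/-- Of three frontier vertices on one side of `ab`, take the middle one: its edge to `a` or `b`
separates the other two, which are nevertheless linked through the territory. -/
theorem OneSided.frontier_subset_pair {f : V → ℕ} (hf : CirclePlacement G f)
    (h : OneSided G f a b s) (hs : s ∉ guarded G a b) {y₁ y₂ : V}
    (h₁ : y₁ ∈ frontier G a b s) (h₂ : y₂ ∈ frontier G a b s) (hne : y₁ ≠ y₂) :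
    frontier G a b s ⊆ {y₁, y₂} := by
  intro y₃ h₃
  by_contra hcon
  simp only [Set.mem_insert_iff, Set.mem_singleton_iff, not_or] at hcon
  have key : ∀ {c y p q}, y ∈ frontier G a b s → p ∈ frontier G a b s → q ∈ frontier G a b s →
      p ≠ y → q ≠ y → (c = a ∨ c = b) → G.Adj c y → ¬ Separates f c y p q := by
    intro c y p q hy hp hq hpy hqy hc hcy
    have aux : ∀ u ∈ territory G a b s ∪ frontier G a b s, u ≠ y → u ∉ ({c, y} : Set V) := by
      rintro u hu huy (rfl | rfl)
      · rcases hc with rfl | rfl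
        · exact left_notMem hs hu
        · exact right_notMem hs hu
      · exact huy rfl
    refine (linkedAvoiding_of_mem ?_ (.inr hp) (.inr hq) (aux _ (.inr hp) hpy)
      (aux _ (.inr hq) hqy)).not_separates hf hcy
    intro t ht
    exact aux t (.inl ht) (by rintro rfl; exact hy.1 ht)
  have key' : ∀ {y p q}, y ∈ frontier G a b s → p ∈ frontier G a b s → q ∈ frontier G a b s →
      p ≠ y → q ≠ y → ¬ Separates f a y p q ∨ ¬ Separates f b y p q := by
    intro y p q hy hp hq hpy hqy
    rcases adj_of_mem_frontier hs hy with hc | hc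
    · exact .inl (key hy hp hq hpy hqy (.inl rfl) hc)
    · exact .inr (key hy hp hq hpy hqy (.inr rfl) hc)
  have k1 := key' h₁ h₂ h₃ hne.symm hcon.1
  have k2 := key' h₂ h₁ h₃ hne hcon.2
  have k3 := key' h₃ h₁ h₂ (Ne.symm hcon.1) (Ne.symm hcon.2)
  have l1 := h _ (.inr h₁) _ (.inr h₂)
  have l2 := h _ (.inr h₁) _ (.inr h₃)
  have l3 := h _ (.inr h₂) _ (.inr h₃)
  have hn : ∀ {u}, u ∈ frontier G a b s → f u ≠ f a ∧ f u ≠ f b := fun {u} hu =>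
    ⟨hf.injective.ne (by rintro rfl; exact left_notMem_frontier hs hu),
      hf.injective.ne (by rintro rfl; exact right_notMem_frontier hs hu)⟩
  have n1 := hn h₁
  have n2 := hn h₂
  have n3 := hn h₃
  have e1 := hf.injective.ne hne
  have e2 := hf.injective.ne hcon.1
  have e3 := hf.injective.ne hcon.2
  clear key key' hn
  unfold Separates at *
  clear h hf hs h₁ h₂ h₃ hne hcon
  rcases lt_trichotomy (f a) (f b) with hab | hab | hab <;> grind (splits := 30)

end LazyZombies

end

/-! ### The strategy of the two zombies. -/

section

open SimpleGraph Relation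

variable {V : Type*}

namespace LazyZombies

variable {G : SimpleGraph V} {f : V → ℕ} {a b s t y : V} {n : ℕ}

/-- The edges that cross the chord between the two zombies. -/
def crossingEdges (G : SimpleGraph V) (f : V → ℕ) (a b : V) : Set (V × V) :=
  {e | G.Adj e.1 e.2 ∧ Separates f a b e.1 e.2}

theorem crossingEdges_comm (G : SimpleGraph V) (f : V → ℕ) (a b : V) :
    crossingEdges G f a b = crossingEdges G f b a := by
  ext e
  exact and_congr_right fun _ => ⟨.symm_left, .symm_left⟩

/-- Following a shortest path to a survivor who is not on its side of a crossing edge, a zombie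
does not meet new edges that cross the chord between the two zombies. -/
theorem crossingEdges_subset (hG : G.Connected) (hf : CirclePlacement G f) {a' x y : V}
    (hxy : G.Adj x y) (hab : Separates f a b x y) (hs : ¬ Separates f x y s b)
    (haa' : G.Adj a a') (hd : G.dist a s = G.dist a' s + 1) :
    crossingEdges G f a' b ⊆ crossingEdges G f a b := by
  have key : ∀ q, G.Adj a q → ¬ Separates f a' b a q := by
    intro q haq hsep
    -- The edge `aq` has `a'` on one side and `b` on the other, and `s` is not on the side of `a'`.
    -- A shortest path from `a'` to `s` through `a` or through `q` then contradicts `hd`.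
    have hlink : ¬ LinkedAvoiding G {a, q} a' s := by
      intro hl
      have hne : a' ∉ ({a, q} : Set V) := by
        rintro (h | h)
        · exact haa'.ne h.symm
        · rw [h] at hsep; exact hsep.2.2.2.1 rfl
      have hsn := hl.notMem hne
      simp only [Set.mem_insert_iff, Set.mem_singleton_iff, not_or] at hsn
      have h1 := hl.not_separates hf haq
      have h2 := hf.noncrossing haq hxy
      have n1 := hf.injective.ne hsn.1
      have n2 := hf.injective.ne hsn.2
      clear * - h1 h2 n1 n2 hsep hs hab
      unfold Separates at *
      grind (splits := 40)
    obtain ⟨w, rfl | rfl, hw⟩ := exists_mem_dist_eq hG hlink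
    · omega
    · have h1 := hG.dist_triangle (u := a) (v := w) (w := s)
      rw [dist_eq_one_iff_adj.mpr haq] at h1
      have h2 : G.dist a' w ≠ 0 := by
        rw [hG.dist_eq_zero_iff.ne]
        rintro rfl
        exact hsep.2.2.2.1 rfl
      omega
  rintro ⟨p, q⟩ ⟨hpq, hsep⟩
  refine ⟨hpq, ?_⟩
  by_contra hcon
  by_cases hp : p = a
  · subst hp; exact key q hpq hsep
  by_cases hq : q = a
  · subst hq; exact key p hpq.symm hsep.symm_right
  have h1 := hf.noncrossing hpq haa'
  have n1 := hf.injective.ne hp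
  have n2 := hf.injective.ne hq
  clear * - hsep hcon h1 n1 n2
  dsimp only at *
  unfold Separates at *
  grind (splits := 30)

variable [Finite V]

/-- A zombie at `a` steps to a frontier vertex `y` on a shortest path to the survivor, the other
frontier vertices being guarded afterwards. -/
theorem canCatch_of_advance (hG : G.Connected) (hf : CirclePlacement G f)
    (ih : ∀ a b s, (territory G a b s).ncard < n → OneSided G f a b s → CanCatch G ![a, b] s)
    (hn : (territory G a b s).ncard < n + 1) (hs : s ∉ guarded G a b)
    (h : OneSided G f a b s) (hy : y ∈ frontier G a b s) (hay : G.Adj a y)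
    (hd : G.dist a s = G.dist y s + 1)
    (hfr : ∀ u ∈ frontier G a b s, u ≠ y → G.Adj b u) : CanCatch G ![a, b] s := by
  have hfr' : frontier G a b s ⊆ guarded G y b := fun u hu => by
    by_cases huy : u = y
    · exact .inl (.inl huy)
    · exact .inr (.inr (hfr u hu huy))
  refine .of_moves (zombieMove_of_dist hG hay hd) (.inl rfl) fun t hst => ?_
  by_cases ht : t ∈ guarded G y b
  · exact .of_guarded hG ht
  have hts := mem_territory_of_move hfr' hst ht
  refine ih _ _ _ ((ncard_territory_lt hfr' hts ht hy (.inl rfl)).trans_le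
    (Nat.lt_succ_iff.1 hn)) ?_
  intro p hp q hq hpq
  have hp' := territory_union_frontier_subset hfr' hts hp
  have hq' := territory_union_frontier_subset hfr' hts hq
  have haK : ∀ u ∈ territory G y b t ∪ frontier G y b t, u ∉ ({a, y} : Set V) := by
    rintro u hu (rfl | rfl)
    · exact left_notMem hs (territory_union_frontier_subset hfr' hts hu)
    · exact left_notMem ht hu
  -- `p`, `q` and `y` are not separated by `ab`, and the edge `ay` does not separate `p` from `q`;
  -- so neither does the third chord `yb`.
  have h1 := (linkedAvoiding_of_mem (fun u hu => haK u (.inl hu)) hp hq (haK p hp)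
    (haK q hq)).not_separates hf hay
  have h2 := h _ hp' _ hq'
  have h3 := h _ (.inr hy) _ hp'
  have h4 := h _ (.inr hy) _ hq'
  have n1 : f p ≠ f a := hf.injective.ne fun e => left_notMem hs (e ▸ hp')
  have n2 : f q ≠ f a := hf.injective.ne fun e => left_notMem hs (e ▸ hq')
  have n3 := hf.injective.ne hay.ne
  clear * - hpq h1 h2 h3 h4 n1 n2 n3
  unfold Separates at *
  grind (splits := 30)

/-- One zombie at `a` guards the frontier, the other steps from `b` to a vertex of it. -/
theorem canCatch_of_adj_frontier (hG : G.Connected) (hf : CirclePlacement G f)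
    (ih : ∀ a b s, (territory G a b s).ncard < n → OneSided G f a b s → CanCatch G ![a, b] s)
    (hn : (territory G a a s).ncard < n + 1) (hs : s ∉ guarded G a a)
    (hy : y ∈ frontier G a a s) (hst : SurvivorMove G s t) : CanCatch G ![a, y] t := by
  have hfr : frontier G a a s ⊆ guarded G a y := fun u hu =>
    .inl (.inr ((adj_of_mem_frontier hs hu).elim id id))
  by_cases ht : t ∈ guarded G a y
  · exact .of_guarded hG ht
  have hts := mem_territory_of_move hfr hst ht
  -- One-sidedness is free: the zombies now stand at the two ends of an edge.
  exact ih _ _ _ ((ncard_territory_lt hfr hts ht hy (.inr rfl)).trans_le (Nat.lt_succ_iff.1 hn))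
    (.of_adj hf ((adj_of_mem_frontier hs hy).elim id id) ht)

theorem canCatch_of_together (hG : G.Connected) (hf : CirclePlacement G f)
    (ih : ∀ a b s, (territory G a b s).ncard < n → OneSided G f a b s → CanCatch G ![a, b] s)
    (hn : (territory G a a s).ncard < n + 1) : CanCatch G ![a, a] s := by
  by_cases hs : s ∈ guarded G a a
  · exact .of_guarded hG hs
  obtain ⟨y, hy, hd⟩ := exists_nearest_mem_frontier hG hs
  have hay := (adj_of_mem_frontier hs hy).elim id id
  exact .of_moves (.inl rfl) (zombieMove_of_dist hG hay (hd a (.inl rfl) hay)) fun t hst =>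
    canCatch_of_adj_frontier hG hf ih hn hs hy hst

/-- The zombie at `a` guards a frontier of two vertices, while the other one, cut off from one of
them by the edge between `a` and the other, joins in. -/
theorem canCatch_of_guarding (hG : G.Connected) (hf : CirclePlacement G f)
    (ih : ∀ a b s, (territory G a b s).ncard < n → OneSided G f a b s → CanCatch G ![a, b] s)
    {y₁ y₂ : V} (m : ℕ) :
    ∀ b s, s ∉ guarded G a a → (territory G a a s).ncard < n + 1 → y₁ ∈ frontier G a a s →
      y₂ ∈ frontier G a a s → Separates f a y₂ y₁ b → G.dist b a + G.dist b y₂ < m →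
      CanCatch G ![a, b] s := by
  induction m with
  | zero => intros; omega
  | succ m ihm =>
    intro b s hs hn hy₁ hy₂ hb hm
    have hay₁ := (adj_of_mem_frontier hs hy₁).elim id id
    have hay₂ := (adj_of_mem_frontier hs hy₂).elim id id
    have hba : b ≠ a := by rintro rfl; exact hb.2.2.2.1 rfl
    have hby : b ≠ y₂ := by rintro rfl; exact hb.2.2.2.2.1 rfl
    have hyy : y₁ ≠ y₂ := by rintro rfl; exact hb.2.2.1 rfl
    have hK : ∀ u ∈ territory G a a s, u ∉ ({a, y₂} : Set V) := by
      rintro u hu (rfl | rfl)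
      · exact left_notMem hs (.inl hu)
      · exact hy₂.1 hu
    -- The survivor is linked to `y₁` through its territory, and the edge between `a` and `y₂` cuts
    -- `y₁` off from `b`.
    have hlink : ¬ LinkedAvoiding G {a, y₂} b s := by
      intro hl
      have := linkedAvoiding_of_mem hK (.inl (mem_territory_self ..)) (.inr hy₁)
        (hK s (mem_territory_self ..)) (by
          rintro (h | h)
          · exact hay₁.ne h.symm
          · exact hyy h)
      exact LinkedAvoiding.not_separates hf hay₂ (ReflTransGen.trans hl this) hb.symm_right
    obtain ⟨b', hbb', hd, hlt⟩ := exists_move_toward_edge hG hay₂ hba hby hlink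
    refine .of_moves (.inl rfl) (zombieMove_of_dist hG hbb' hd) fun t hst => ?_
    by_cases hba' : b' = y₂
    · subst hba'
      exact canCatch_of_adj_frontier hG hf ih hn hs hy₂ hst
    have hfr : frontier G a a s ⊆ guarded G a a := fun u hu =>
      .inl (.inr ((adj_of_mem_frontier hs hu).elim id id))
    by_cases ht : t ∈ guarded G a a
    · exact .of_guarded hG (.inl (ht.elim id id))
    have hts := mem_territory_of_move hfr hst ht
    have hte := territory_eq hs hts
    by_cases hba'' : b' = a
    · subst hba''
      exact canCatch_of_together hG hf ih (by rwa [hte])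
    refine ihm b' t ht (by rwa [hte]) (by rwa [frontier, hte]) (by rwa [frontier, hte]) ?_
      (by omega)
    have h1 := hf.noncrossing hay₂ hbb'
    have n1 := hf.injective.ne hba'
    have n2 := hf.injective.ne hba''
    clear * - h1 n1 n2 hb
    unfold Separates at *
    grind (splits := 30)

theorem canCatch_of_oneSided (hG : G.Connected) (hf : CirclePlacement G f) (n : ℕ) :
    ∀ a b s, (territory G a b s).ncard < n → OneSided G f a b s → CanCatch G ![a, b] s := by
  induction n with
  | zero => intros; omega
  | succ n ih =>
    intro a b s hn h
    by_cases hs : s ∈ guarded G a b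
    · exact .of_guarded hG hs
    obtain ⟨y, hy, hd⟩ := exists_nearest_mem_frontier hG hs
    wlog hay : G.Adj a y generalizing a b
    · refine (this b a (by rwa [territory_comm]) h.swap (by rwa [guarded_comm])
        (by rwa [frontier_comm]) (fun c hc => hd c hc.symm) ?_).swap
      exact (adj_of_mem_frontier hs hy).resolve_left hay
    by_cases hfr : ∀ u ∈ frontier G a b s, u ≠ y → G.Adj b u
    · exact canCatch_of_advance hG hf ih hn hs h hy hay (hd a (.inl rfl) hay) hfr
    push Not at hfr
    obtain ⟨u, hu, huy, hbu⟩ := hfr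
    have hau := (adj_of_mem_frontier hs hu).resolve_right hbu
    have hsub := h.frontier_subset_pair hf hs hy hu huy.symm
    have hadj : ∀ v ∈ frontier G a b s, G.Adj a v := by
      intro v hv
      rcases hsub hv with rfl | rfl <;> assumption
    -- Since `a` alone guards the frontier, `b` can leave without enlarging the territory.
    have hT : territory G a a s = territory G a b s := by
      refine Set.Subset.antisymm (territory_subset (fun v hv => .inl (.inr (hadj v hv)))
        (mem_territory_self ..)) fun v hv => LinkedAvoiding.mono hv ?_
      rintro w (hw | hw) <;> exact .inl hw
    have hs' : s ∉ guarded G a a := fun h => hs (.inl (h.elim id id))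
    rcases eq_or_ne b a with rfl | hba
    · exact canCatch_of_together hG hf ih hn
    have hF : frontier G a a s = frontier G a b s := by rw [frontier, hT, frontier]
    have n1 := hf.injective.ne hba
    have n2 := hf.injective.ne huy
    have n3 := hf.injective.ne hau.ne
    have n4 := hf.injective.ne hay.ne
    have n5 : f b ≠ f u := hf.injective.ne (by rintro rfl; exact right_notMem_frontier hs hu)
    have n6 : f b ≠ f y := hf.injective.ne (by rintro rfl; exact right_notMem_frontier hs hy)
    have h1 := h _ (.inr hy) _ (.inr hu)
    -- `y` and `u` lie on the same arc between `a` and `b`; the edge from `a` to the one nearer to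
    -- `b` along this arc separates the other from `b`.
    have : Separates f a y u b ∨ Separates f a u y b := by
      clear * - n1 n2 n3 n4 n5 n6 h1
      unfold Separates at *
      grind (splits := 30)
    rcases this with hsep | hsep
    · exact canCatch_of_guarding hG hf ih _ b s hs' (by rwa [hT]) (by rwa [hF]) (by rwa [hF])
        hsep (Nat.lt_succ_self _)
    · exact canCatch_of_guarding hG hf ih _ b s hs' (by rwa [hT]) (by rwa [hF]) (by rwa [hF])
        hsep (Nat.lt_succ_self _)

theorem canCatch (hG : G.Connected) (hf : CirclePlacement G f) (n : ℕ) :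
    ∀ a b s, (crossingEdges G f a b).ncard < n → CanCatch G ![a, b] s := by
  induction n with
  | zero => intros; omega
  | succ n ih =>
    intro a b s hn
    by_cases hs : s ∈ guarded G a b
    · exact .of_guarded hG hs
    by_cases hx : ∃ x y, G.Adj x y ∧ Separates f a b x y
    · obtain ⟨x, y, hxy, hsep⟩ := hx
      have inner : ∀ m a b s, (crossingEdges G f a b).ncard < n + 1 → Separates f a b x y →
          G.dist a x + G.dist a y + (G.dist b x + G.dist b y) < m → CanCatch G ![a, b] s := by
        intro m
        induction m with
        | zero => intros; omega
        | succ m ihm =>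
          intro a b s hn hsep hm
          -- By symmetry `a` is a zombie that is not on the survivor's side of `xy`.
          wlog hsb : ¬ Separates f x y s b generalizing a b
          · refine (this b a (by rwa [crossingEdges_comm]) hsep.symm_left (by omega)
              fun h => ?_).swap
            clear * - hsb hsep h
            unfold Separates at *
            grind (splits := 30)
          have hax : a ≠ x := by rintro rfl; exact hsep.2.1 rfl
          have hay : a ≠ y := by rintro rfl; exact hsep.2.2.2.1 rfl
          have hlink : ¬ LinkedAvoiding G {x, y} a s := by
            intro hl
            have hsn := hl.notMem (by rintro (h | h); exacts [hax h, hay h])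
            simp only [Set.mem_insert_iff, Set.mem_singleton_iff, not_or] at hsn
            have h1 := hl.not_separates hf hxy
            have n1 := hf.injective.ne hsn.1
            have n2 := hf.injective.ne hsn.2
            clear * - h1 n1 n2 hsep hsb
            unfold Separates at *
            grind (splits := 30)
          obtain ⟨a', haa', hd, hlt⟩ := exists_move_toward_edge hG hxy hax hay hlink
          have hsub := crossingEdges_subset hG hf hxy hsep hsb haa' hd
          have hle := Set.ncard_le_ncard hsub (Set.toFinite _)
          refine .of_moves (zombieMove_of_dist hG haa' hd) (.inl rfl) fun t _ => ?_
          by_cases ha' : a' = x ∨ a' = y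
          · refine ih _ _ _ (lt_of_lt_of_le (Set.ncard_lt_ncard ⟨hsub, fun hsup => ?_⟩
              (Set.toFinite _)) (Nat.lt_succ_iff.1 hn))
            have := (hsup (show (x, y) ∈ crossingEdges G f a b from ⟨hxy, hsep⟩)).2
            rcases ha' with rfl | rfl
            · exact this.2.1 rfl
            · exact this.2.2.2.1 rfl
          -- The edge from `a` to `a'` does not cross `xy`, so `xy` still separates the zombies and
          -- only the sum of distances has dropped.
          · rw [not_or] at ha'
            refine ihm a' b t (by omega) ?_ (by omega)
            have h1 := hf.noncrossing hxy haa'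
            have n1 := hf.injective.ne ha'.1
            have n2 := hf.injective.ne ha'.2
            clear * - h1 n1 n2 hsep
            unfold Separates at *
            grind (splits := 30)
      exact inner _ a b s hn hsep (Nat.lt_succ_self _)
    · refine canCatch_of_oneSided hG hf _ a b s (Nat.lt_succ_self _) fun p hp q hq hpq => hx ?_
      exact (linkedAvoiding_pair hs hp hq).exists_separated_edge hf.injective hpq

theorem universallyWin_two (hG : G.Connected) (hf : CirclePlacement G f) :
    UniversallyWin G 2 := by
  intro z s
  have hz : z = ![z 0, z 1] := by ext i; fin_cases i <;> rfl
  rw [hz]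
  exact canCatch hG hf _ _ _ s (Nat.lt_succ_self _)

end LazyZombies

end

/-! ### From a drawing in the disc to an order on the circle. -/

section

open Complex

/-- The argument of the chord `1 - exp (θ * I)` of the unit circle. -/
theorem log_one_sub_exp_im_of_pos {θ : ℝ} (h0 : 0 < θ) (h1 : θ < 2 * Real.pi) :
    (log (1 - exp (θ * I))).im = (θ - Real.pi) / 2 := by
  have hs : 0 < Real.sin (θ / 2) := Real.sin_pos_of_pos_of_lt_pi (by linarith) (by linarith)
  have e : 1 - exp (θ * I) = ((2 * Real.sin (θ / 2) : ℝ) : ℂ) *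
      (Real.cos ((θ - Real.pi) / 2) + Real.sin ((θ - Real.pi) / 2) * I) := by
    have e1 : (θ - Real.pi) / 2 = θ / 2 - Real.pi / 2 := by ring
    have e2 : θ = 2 * (θ / 2) := by ring
    rw [e1, Real.cos_sub_pi_div_two, Real.sin_sub_pi_div_two, exp_mul_I, ← ofReal_cos,
      ← ofReal_sin]
    nth_rw 1 2 [e2]
    rw [Real.cos_two_mul, Real.sin_two_mul]
    have := Real.sin_sq_add_cos_sq (θ / 2)
    generalize Real.sin (θ / 2) = S at this ⊢
    generalize Real.cos (θ / 2) = C at this ⊢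
    have h : (S : ℂ) ^ 2 + (C : ℂ) ^ 2 = 1 := by exact_mod_cast this
    push_cast
    linear_combination -2 * h
  rw [log_im, e, ofReal_cos, ofReal_sin, arg_mul_cos_add_sin_mul_I (by linarith)]
  constructor <;> linarith

theorem log_one_sub_exp_im_of_neg {θ : ℝ} (h0 : θ < 0) (h1 : -(2 * Real.pi) < θ) :
    (log (1 - exp (θ * I))).im = (θ + Real.pi) / 2 := by
  have := log_one_sub_exp_im_of_pos (θ := θ + 2 * Real.pi) (by linarith) (by linarith)
  rw [show ((θ + 2 * Real.pi : ℝ) : ℂ) * I = θ * I + 2 * Real.pi * I by push_cast; ring,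
    exp_periodic] at this
  rw [this]; ring

/-- A continuous logarithm of `c * (1 - w t)`, where `w` stays in the unit disc and avoids `1`,
changes as the principal branch. -/
theorem log_one_sub_difference {w L : ℝ → ℂ} (hw : Continuous w) (hL : Continuous L) {c : ℂ}
    (hwn : ∀ t, ‖w t‖ ≤ 1) (hw1 : ∀ t, w t ≠ 1) (hLw : ∀ t, exp (L t) = c * (1 - w t)) (t u : ℝ) :
    L t - log (1 - w t) = L u - log (1 - w u) := by
  -- The only point of the unit disc with real part `1` is `1`, so `1 - w t` stays in a half-plane
  -- where the principal logarithm is continuous.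
  have hre : ∀ t, 0 < (1 - w t).re := by
    intro t
    have h1 := (re_le_norm (w t)).trans (hwn t)
    rcases h1.lt_or_eq with h | h
    · simpa using h
    · refine absurd ?_ (hw1 t)
      have h2 := sq_norm_sub_sq_re (w t)
      have h3 : ‖w t‖ = 1 := le_antisymm (hwn t) (h ▸ re_le_norm (w t))
      rw [h3, h] at h2
      apply Complex.ext
      · simpa using h
      · simpa using h2.symm
  have hcont : Continuous fun t => L t - log (1 - w t) :=
    hL.sub ((continuous_const.sub hw).clog fun t => .inl (hre t))
  have hexp : ∀ t, exp (L t - log (1 - w t)) = c := by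
    intro t
    have hne : 1 - w t ≠ 0 := fun h => by simpa [h] using hre t
    rw [exp_sub, exp_log hne, hLw, mul_div_assoc, div_self hne, mul_one]
  exact isCoveringMap_exp.const_of_comp hcont
    (fun a b => Subtype.ext ((hexp a).trans (hexp b).symm)) t u

/-- Two paths in the closed unit disc whose ends alternate on the unit circle meet. -/
theorem exists_eq_of_alternating {α β γ δ : ℝ} (hαβ : α < β) (hβγ : β < γ) (hγδ : γ < δ)
    (hδα : δ < α + 2 * Real.pi) {P Q : ℝ → ℂ} (hP : Continuous P) (hQ : Continuous Q)
    (hPn : ∀ t, ‖P t‖ ≤ 1) (hQn : ∀ t, ‖Q t‖ ≤ 1) (hP0 : P 0 = exp (α * I))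
    (hP1 : P 1 = exp (γ * I)) (hQ0 : Q 0 = exp (β * I)) (hQ1 : Q 1 = exp (δ * I)) :
    ∃ s t, P s = Q t := by
  by_contra! hne
  -- If the paths never meet, `P s - Q t` has a continuous logarithm on the plane, whose change
  -- around the boundary of the unit square is zero. On each side one of the two points is fixed on
  -- the circle, so the change of argument there can be computed.
  obtain ⟨L, ⟨-, hLe⟩, -⟩ := isCoveringMapOn_exp.existsUnique_continuousMap_lifts
    (⟨fun p => P p.1 - Q p.2, by fun_prop⟩ : C(ℝ × ℝ, ℂ)) (a₀ := (0, 0))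
    (exp_log (sub_ne_zero.2 (hne 0 0))) (fun p => sub_ne_zero.2 (hne p.1 p.2))
  have hLe : ∀ s t, exp (L (s, t)) = P s - Q t := fun s t => congrFun hLe (s, t)
  have hn : ∀ θ : ℝ, ‖exp (-(θ * I))‖ = 1 := fun θ => by
    rw [← neg_mul, ← ofReal_neg, norm_exp_ofReal_mul_I]
  have hinv : ∀ θ : ℝ, exp (θ * I) * exp (-(θ * I)) = 1 := fun θ => by
    rw [← exp_add, add_neg_cancel, exp_zero]
  have hsub : ∀ θ η : ℝ, exp (η * I) * exp (-(θ * I)) = exp ((η - θ : ℝ) * I) := fun θ η => by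
    rw [← exp_add]; congr 1; push_cast; ring
  have hQside : ∀ s (θ : ℝ), P s = exp (θ * I) →
      (L (s, 1)).im - (L (s, 0)).im =
        (log (1 - exp ((δ - θ : ℝ) * I))).im - (log (1 - exp ((β - θ : ℝ) * I))).im := by
    intro s θ hs
    have := log_one_sub_difference (w := fun t => Q t * exp (-(θ * I)))
      (L := fun t => L (s, t)) (c := exp (θ * I)) (by fun_prop) (by fun_prop)
      (fun t => by rw [norm_mul, hn, mul_one]; exact hQn t)
      (fun t h => hne s t (by
        rw [hs]
        linear_combination (-exp (θ * I)) * h + Q t * hinv θ))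
      (fun t => by rw [hLe, hs]; linear_combination (Q t) * hinv θ) 1 0
    simp only [hQ0, hQ1, hsub] at this
    have := congrArg im this
    simp only [sub_im] at this
    linarith
  have hPside : ∀ t (θ : ℝ), Q t = exp (θ * I) →
      (L (1, t)).im - (L (0, t)).im =
        (log (1 - exp ((γ - θ : ℝ) * I))).im - (log (1 - exp ((α - θ : ℝ) * I))).im := by
    intro t θ ht
    have := log_one_sub_difference (w := fun s => P s * exp (-(θ * I)))
      (L := fun s => L (s, t)) (c := -exp (θ * I)) (by fun_prop) (by fun_prop)
      (fun s => by rw [norm_mul, hn, mul_one]; exact hPn s)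
      (fun s h => hne s t (by
        rw [ht]
        linear_combination exp (θ * I) * h - P s * hinv θ))
      (fun s => by rw [hLe, ht]; linear_combination (-P s) * hinv θ) 1 0
    simp only [hP0, hP1, hsub] at this
    have := congrArg im this
    simp only [sub_im] at this
    linarith
  have s1 := hQside 0 α hP0
  have s2 := hQside 1 γ hP1
  have s3 := hPside 0 β hQ0
  have s4 := hPside 1 δ hQ1
  rw [log_one_sub_exp_im_of_pos (by linarith) (by linarith),
    log_one_sub_exp_im_of_pos (by linarith) (by linarith)] at s1
  rw [log_one_sub_exp_im_of_pos (by linarith) (by linarith),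
    log_one_sub_exp_im_of_neg (by linarith) (by linarith)] at s2
  rw [log_one_sub_exp_im_of_pos (by linarith) (by linarith),
    log_one_sub_exp_im_of_neg (by linarith) (by linarith)] at s3
  rw [log_one_sub_exp_im_of_neg (by linarith) (by linarith),
    log_one_sub_exp_im_of_neg (by linarith) (by linarith)] at s4
  -- The two routes from `(0, 0)` to `(1, 1)` give changes of argument that differ by `2π`: `s1 +
  -- s4` against `s2 + s3`.
  linarith [Real.pi_pos]

/-- The order of the vertices of an outerplanar graph around the disc. -/
theorem IsOuterplanar.exists_circlePlacement {V : Type*} [Finite V] {G : SimpleGraph V}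
    (h : IsOuterplanar G) : ∃ f : V → ℕ, CirclePlacement G f := by
  obtain ⟨pos, arc, hinj, hcirc, hpath, hdisc, -, hmeet⟩ := h
  have hnorm : ∀ v, ‖pos v‖ = 1 := fun v => by simpa using hcirc v
  have hpos : ∀ v, exp ((pos v).arg * I) = pos v := fun v => by
    simpa [hnorm v] using norm_mul_exp_arg_mul_I (pos v)
  let θ : V → ℝ := fun v => (pos v).arg
  have hθ : Function.Injective θ := fun u v huv => hinj (by
    rw [← hpos u, ← hpos v]; simp only [θ] at huv; rw [huv])
  -- The rank of `v` when the vertices are sorted by argument.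
  let f : V → ℕ := fun v => {w | θ w < θ v}.ncard
  have hlt : ∀ {u v}, θ u < θ v → f u < f v := fun {u v} huv =>
    Set.ncard_lt_ncard ⟨fun w hw => lt_trans hw huv, fun hsub => lt_irrefl (θ u) (hsub huv)⟩
      (Set.toFinite _)
  have hle : ∀ {u v}, f u < f v → θ u < θ v := fun {u v} huv => by
    rcases lt_trichotomy (θ u) (θ v) with h | h | h
    · exact h
    · rw [hθ h] at huv; exact absurd huv (lt_irrefl _)
    · exact absurd (hlt h) huv.asymm
  have key : ∀ {u v p q}, G.Adj u v → G.Adj p q → f u < f p → f p < f v → f v < f q →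
      False := by
    intro u v p q huv hpq h1 h2 h3
    obtain ⟨γ, -, hγ⟩ := hpath u v huv
    obtain ⟨η, -, hη⟩ := hpath p q hpq
    have hn : ∀ {u v : V} (γ : Path (pos u) (pos v)), G.Adj u v → Set.range γ = arc s(u, v) →
        ∀ t, ‖γ.extend t‖ ≤ 1 := by
      intro u v γ huv hγ t
      have : γ.extend t ∈ Set.range γ := by
        rw [← γ.extend_range]; exact ⟨t, rfl⟩
      rw [hγ] at this
      simpa using hdisc _ huv this
    have hup : u ≠ p := by rintro rfl; omega
    have huq : u ≠ q := by rintro rfl; omega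
    have hvp : v ≠ p := by rintro rfl; omega
    have hvq : v ≠ q := by rintro rfl; omega
    obtain ⟨s, t, hst⟩ := exists_eq_of_alternating (hle h1) (hle h2) (hle h3)
      (by
        have := neg_pi_lt_arg (pos u)
        have := arg_le_pi (pos q)
        simp only [θ]; linarith)
      γ.continuous_extend η.continuous_extend (hn γ huv hγ) (hn η hpq hη)
      (by simp [θ, hpos]) (by simp [θ, hpos]) (by simp [θ, hpos]) (by simp [θ, hpos])
    have m1 : γ.extend s ∈ arc s(u, v) := by
      rw [← hγ, ← γ.extend_range]; exact ⟨s, rfl⟩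
    have m2 : γ.extend s ∈ arc s(p, q) := by
      rw [hst, ← hη, ← η.extend_range]; exact ⟨t, rfl⟩
    obtain ⟨w, ⟨hw1, hw2⟩, -⟩ := hmeet _ huv _ hpq (by
      intro h
      rcases Sym2.eq_iff.1 h with h | h
      · exact hup h.1
      · exact huq h.1) ⟨m1, m2⟩
    rcases Sym2.mem_iff.1 hw1 with rfl | rfl <;> rcases Sym2.mem_iff.1 hw2 with h | h
    exacts [hup h, huq h, hvp h, hvq h]
  refine ⟨f, fun u v huv => hθ ?_, fun u v p q huv hpq hs => ?_⟩
  · rcases lt_trichotomy (θ u) (θ v) with h | h | h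
    · exact absurd huv (hlt h).ne
    · exact h
    · exact absurd huv (hlt h).ne'
  · have k1 := @key u v p q huv hpq
    have k2 := @key v u p q huv.symm hpq
    have k3 := @key u v q p huv hpq.symm
    have k4 := @key v u q p huv.symm hpq.symm
    have k5 := @key p q u v hpq huv
    have k6 := @key q p u v hpq.symm huv
    have k7 := @key p q v u hpq huv.symm
    have k8 := @key q p v u hpq.symm huv.symm
    clear * - hs k1 k2 k3 k4 k5 k6 k7 k8
    unfold Separates at hs
    grind (splits := 40)

end

/-! ### The lower bound and the 4-cycle. -/

section

open SimpleGraph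

namespace LazyZombies

variable {V : Type*} {G : SimpleGraph V}

theorem not_canCatch_of_no_zombie {z : Fin 0 → V} {s : V} : ¬ CanCatch G z s := by
  intro h
  induction h with
  | caught hc => exact hc.choose.elim0
  | capture _ _ hc => exact hc.choose.elim0
  | round _ _ _ ih => exact ih _ (.inl rfl)

theorem universalLazyZombieNumber_le {k : ℕ} (h : UniversallyWin G k) :
    universalLazyZombieNumber G ≤ k := iInf₂_le k h

/-- The value `0` is excluded because a survivor without zombies can wait forever. -/
theorem universalLazyZombieNumber_eq_two_iff [Nonempty V] (h : UniversallyWin G 2) :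
    universalLazyZombieNumber G = 2 ↔ ¬ UniversallyWin G 1 := by
  constructor
  · intro h2 h1
    have := universalLazyZombieNumber_le h1
    rw [h2] at this
    exact absurd this (by norm_num)
  · intro h1
    refine le_antisymm (universalLazyZombieNumber_le h) (le_iInf₂ fun k hk => ?_)
    match k, hk with
    | 0, hk => exact (not_canCatch_of_no_zombie (hk Fin.elim0 (Classical.arbitrary V))).elim
    | 1, hk => exact (h1 hk).elim
    | k + 2, _ => exact_mod_cast Nat.le_add_left 2 k

/-- On the 4-cycle, the survivor escapes a single zombie by keeping opposite to it. -/
theorem not_universallyWin_one_cycleGraph_four : ¬ UniversallyWin (cycleGraph 4) 1 := by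
  have key : ∀ {z : Fin 1 → Fin 4} {s : Fin 4}, CanCatch (cycleGraph 4) z s → s ≠ z 0 + 2 := by
    intro z s h
    have opp : ∀ x : Fin 4, ¬ (cycleGraph 4).Adj x (x + 2) ∧ x ≠ x + 2 := by decide
    have step : ∀ {x y s : Fin 4}, ZombieMove (cycleGraph 4) s x y →
        y = x ∨ (cycleGraph 4).Adj x y := fun h => h.imp id fun ⟨h, _⟩ => h
    induction h with
    | caught hc =>
      obtain ⟨i, rfl⟩ := hc
      rw [Subsingleton.elim i 0]
      exact (opp _).2
    | @capture z s z' hz hc =>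
      rintro rfl
      obtain ⟨i, hi⟩ := hc
      rw [Subsingleton.elim i 0] at hi
      rcases step (hz 0) with h | h
      · exact (opp (z 0)).2 (h ▸ hi)
      · exact (opp (z 0)).1 (hi ▸ h)
    | @round z s z' hz _ ih =>
      rintro rfl
      refine ih (z' 0 + 2) ?_ rfl
      rcases step (hz 0) with h | h
      · exact .inl (by rw [h])
      · have : ∀ x y : Fin 4, (cycleGraph 4).Adj x y → (cycleGraph 4).Adj (x + 2) (y + 2) := by
          decide
        exact .inr (this _ _ h)
  exact fun h => key (h ![0] 2) rfl

end LazyZombies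

theorem isOuterplanar_cycleGraph_four : IsOuterplanar (cycleGraph 4) := by
  let pos : Fin 4 → ℂ := ![1, Complex.I, -1, -Complex.I]
  have hmem : ∀ {u v z}, z ∈ segment ℝ (pos u) (pos v) → ∃ a b : ℝ, 0 ≤ a ∧ 0 ≤ b ∧
      a + b = 1 ∧ z.re = a * (pos u).re + b * (pos v).re ∧
      z.im = a * (pos u).im + b * (pos v).im := by
    rintro u v z ⟨a, b, ha, hb, hab, rfl⟩
    exact ⟨a, b, ha, hb, hab, by simp, by simp⟩
  let arc : Sym2 (Fin 4) → Set ℂ := Sym2.lift ⟨fun u v => segment ℝ (pos u) (pos v),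
    fun u v => segment_symm ℝ _ _⟩
  have hnorm : ∀ v, ‖pos v‖ = 1 := by intro v; fin_cases v <;> simp [pos]
  have hinj : Function.Injective pos := by
    intro u v h
    fin_cases u <;> fin_cases v <;> first
      | rfl
      | (exfalso; norm_num [pos, Complex.ext_iff] at h)
  refine ⟨pos, arc, hinj, by simpa using hnorm, ?_, ?_, ?_, ?_⟩
  · intro u v huv
    have hne : pos u ≠ pos v := hinj.ne huv.ne
    refine ⟨⟨⟨fun t => AffineMap.lineMap (pos u) (pos v) (t : ℝ), by fun_prop⟩, by simp,
      by simp⟩, ?_, ?_⟩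
    · intro s t hst
      exact Subtype.ext (AffineMap.lineMap_injective ℝ hne hst)
    · change Set.range (fun t : unitInterval => AffineMap.lineMap (pos u) (pos v) (t : ℝ)) =
        segment ℝ (pos u) (pos v)
      rw [segment_eq_image_lineMap]
      ext z
      simp
  · intro e
    induction e with | _ u v =>
    intro _
    exact (convex_closedBall (0 : ℂ) 1).segment_subset (by simp [hnorm]) (by simp [hnorm])
  · intro e
    induction e with | _ u v =>
    intro huv w hw
    obtain ⟨a, b, ha, hb, hab, h1, h2⟩ := hmem hw
    rw [mem_edgeSet] at huv
    fin_cases u <;> fin_cases v <;> fin_cases w <;>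
      first
      | (exfalso; revert huv; decide)
      | decide
      | (exfalso; norm_num [pos] at h1 h2; linarith)
  · have hedge : ∀ e ∈ (cycleGraph 4).edgeSet,
        e = s(0, 1) ∨ e = s(1, 2) ∨ e = s(2, 3) ∨ e = s(3, 0) := by
      intro e
      induction e with | _ u v =>
      rw [mem_edgeSet]
      revert u v
      decide
    have r0 : (pos 0).re = 1 ∧ (pos 0).im = 0 := by simp [pos]
    have r1 : (pos 1).re = 0 ∧ (pos 1).im = 1 := by simp [pos]
    have r2 : (pos 2).re = -1 ∧ (pos 2).im = 0 := by simp [pos]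
    have r3 : (pos 3).re = 0 ∧ (pos 3).im = -1 := by simp [pos]
    clear_value pos
    intro e he e' he' hne z hz
    have common : ∀ w, w ∈ e → w ∈ e' → z.re = (pos w).re → z.im = (pos w).im →
        z ∈ pos '' {w | w ∈ e ∧ w ∈ e'} :=
      fun w hi hj hre him => ⟨w, ⟨hi, hj⟩, (Complex.ext hre him).symm⟩
    rcases hedge e he with rfl | rfl | rfl | rfl <;>
    rcases hedge e' he' with rfl | rfl | rfl | rfl <;>
    -- Opposite sides of the square are disjoint, and consecutive ones meet only in their common
    -- corner, which is found by trial.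
    first
    | exact absurd rfl hne
    | (obtain ⟨a, b, ha, hb, hab, h1, h2⟩ := hmem hz.1
       obtain ⟨c, d, hc, hd, hcd, h3, h4⟩ := hmem hz.2
       simp only [r0, r1, r2, r3] at h1 h2 h3 h4
       clear hz hne he he'
       first
       | (exfalso; linarith)
       | exact common 0 (by decide) (by decide) (by rw [r0.1]; linarith) (by rw [r0.2]; linarith)
       | exact common 1 (by decide) (by decide) (by rw [r1.1]; linarith) (by rw [r1.2]; linarith)
       | exact common 2 (by decide) (by decide) (by rw [r2.1]; linarith) (by rw [r2.2]; linarith)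
       | exact common 3 (by decide) (by decide) (by rw [r3.1]; linarith) (by rw [r3.2]; linarith))

end

theorem corollary1 :
    (∀ (V : Type*) [Finite V] (G : SimpleGraph V), G.Connected → IsOuterplanar G →
      LazyZombies.UniversallyWin G 2 ∧
      LazyZombies.universalLazyZombieNumber G ≤ 2 ∧
      (LazyZombies.universalLazyZombieNumber G = 2 ↔ ¬ LazyZombies.UniversallyWin G 1)) ∧
    ((SimpleGraph.cycleGraph 4).Connected ∧ IsOuterplanar (SimpleGraph.cycleGraph 4) ∧
      LazyZombies.universalLazyZombieNumber (SimpleGraph.cycleGraph 4) = 2) := by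
  have main : ∀ {V : Type _} [Finite V] {G : SimpleGraph V}, G.Connected → IsOuterplanar G →
      LazyZombies.UniversallyWin G 2 := fun hG h =>
    let ⟨_, hf⟩ := h.exists_circlePlacement
    LazyZombies.universallyWin_two hG hf
  refine ⟨fun V _ G hG h => ?_, SimpleGraph.cycleGraph_connected, isOuterplanar_cycleGraph_four, ?_⟩
  · have := hG.nonempty
    have h2 := main hG h
    exact ⟨h2, LazyZombies.universalLazyZombieNumber_le h2,
      LazyZombies.universalLazyZombieNumber_eq_two_iff h2⟩
  · obtain ⟨_, hf⟩ := isOuterplanar_cycleGraph_four.exists_circlePlacement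
    exact (LazyZombies.universalLazyZombieNumber_eq_two_iff
      (LazyZombies.universallyWin_two (SimpleGraph.cycleGraph_connected) hf)).2
      LazyZombies.not_universallyWin_one_cycleGraph_four
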